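/- Let $\varphi(q)=\sum_{k=-\infty}^{\infty}q^{k^2}$ be Ramanujan's theta function, and define integers $ph_3(n)$, $n\ge 0$, by the formal power series identity $$\sum_{n\ge 0}ph_3(n)\,q^n=\frac{\varphi(-q^3)}{\varphi(-q)}.$$ Then for all integers $m\ge 1$ and $n\ge 0$, $$ph_3\big(3^{2m+1}n\big)\equiv ph_3\big(3^{2m-1}n\big)\pmod{3^{m+2}}.$$ -/

import Mathlib

open scoped PowerSeries

/-- Ramanujan's theta function `φ(q) = ∑_{k ∈ ℤ} q^(k^2)`, as a formal power series in `q`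
with integer coefficients: the coefficient of `q^n` is the number of `k ∈ ℤ` with `k^2 = n`. -/
noncomputable def ramanujanPhi : ℤ⟦X⟧ :=
  PowerSeries.mk fun n => ({k : ℤ | k ^ 2 = (n : ℤ)}.ncard : ℤ)

/-- The index sets counted in `ramanujanPhi` are finite. -/
theorem finite_setOf_sq_eq (n : ℕ) : {k : ℤ | k ^ 2 = (n : ℤ)}.Finite := by
  refine (Set.finite_Icc (-(n : ℤ)) (n : ℤ)).subset ?_
  intro k hk
  have hk' : k ^ 2 = (n : ℤ) := hk
  constructor <;> nlinarith [sq_nonneg (k - 1), sq_nonneg (k + 1), Int.le_self_sq k,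
    Int.le_self_sq (-k)]

/-- `φ(-q)`. -/
noncomputable def phiNeg : ℤ⟦X⟧ :=
  PowerSeries.rescale (-1 : ℤ) ramanujanPhi

/-- `φ(-q^3)`, that is `φ(-q)` with `q` replaced by `q^3`. -/
noncomputable def phiNegCube : ℤ⟦X⟧ :=
  PowerSeries.expand 3 (by norm_num) phiNeg

theorem constantCoeff_phiNeg : PowerSeries.constantCoeff phiNeg = ((1 : ℤˣ) : ℤ) := by
  have h : {k : ℤ | k ^ 2 = ((0 : ℕ) : ℤ)} = {0} := by
    ext k; simp
  rw [← PowerSeries.coeff_zero_eq_constantCoeff_apply, phiNeg, PowerSeries.coeff_rescale,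
    ramanujanPhi, PowerSeries.coeff_mk, h]
  simp

/-- The generating function `φ(-q^3) / φ(-q)`; the denominator has constant term `1`,
so it is invertible in `ℤ⟦X⟧`. -/
noncomputable def ph3Series : ℤ⟦X⟧ :=
  phiNegCube * PowerSeries.invOfUnit phiNeg 1

/-- `ph3Series` is indeed the quotient of `φ(-q^3)` by `φ(-q)`. -/
theorem ph3Series_mul_phiNeg : ph3Series * phiNeg = phiNegCube := by
  rw [ph3Series, mul_assoc, PowerSeries.invOfUnit_mul phiNeg 1 constantCoeff_phiNeg, mul_one]

/-- `ph_3(n)`, the coefficient of `q^n` in `φ(-q^3) / φ(-q)`. -/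
noncomputable def ph3 (n : ℕ) : ℤ :=
  PowerSeries.coeff n ph3Series

/-! Write `U` for `trisect` and `P` for `ph3Series`. Multiplying Gauss's product for `φ(-q)` over
`q, ωq, ω²q` (`ω` a primitive cube root of unity) gives `phiNeg_cubic`, hence the modular equation
`ph3Series_cubic`, a cubic for `P` over `ℤ[P(q^3)]`. Since `U` is linear over series in `q^3`, each
`U(P^k)` is a polynomial in `P`; in particular `U(P) = P^3`.

With `s = P^4 - 1`, `U` carries `P·ℤ[s]` into `P^3·ℤ[s]` and `P^3·ℤ[s]` into `P·ℤ[s]`. Give `3^v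
s^j` the weight `2v - 3j`. The bounds `trisect_mul_pow_wt` and `trisect_cube_mul_pow_wt` control how
`U` changes weights on terms with `j ≥ 1`. Starting from `U^3 P - U P`, which is `P^3` times terms
of weight at least `2`, every two further applications of `U` gain weight `2`
(`iterate_trisect_sub`), and weight `2m` with `j ≥ 1` forces the factor `3^(m+2)`. -/

/-! ### Finite form of Gauss's identity -/

section Gauss

open Finset

/-- Telescoping step for the finite form of Gauss's identity for `φ(-q)`. -/
theorem gauss_telescope {R : Type*} [CommRing R] (x : R) (i : ℕ → R)
    (hi : ∀ k, 1 ≤ k → (1 + x ^ k) * i k = 1) (n m : ℕ) (hm : m ≤ n) :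
    (∏ k ∈ range (n + 1), ((1 - x ^ (k + 1)) * i (k + 1))
        - ∏ k ∈ range n, ((1 - x ^ (k + 1)) * i (k + 1)))
      + 2 * ∑ s ∈ range m, (-1) ^ (s + 1) * i (s + 1) *
          (x ^ ((s + 1) * (n + 2)) * ∏ k ∈ Ico (s + 1) (n + 1), ((1 - x ^ (k + 1)) * i (k + 1))
          - x ^ ((s + 1) * (n + 1)) * ∏ k ∈ Ico (s + 1) n, ((1 - x ^ (k + 1)) * i (k + 1)))
      = 2 * (-1) ^ (m + 1) * i (n + 1) * x ^ ((m + 1) * (n + 1)) *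
          ∏ k ∈ Ico m n, ((1 - x ^ (k + 1)) * i (k + 1)) := by
  induction m with
  | zero =>
    have h := hi (n + 1) (by omega)
    rw [prod_range_succ, range_eq_Ico]
    simp only [range_zero, sum_empty]
    linear_combination (∏ k ∈ Ico 0 n, ((1 - x ^ (k + 1)) * i (k + 1))) * h
  | succ m ih =>
    have ih := ih (by omega)
    have h1 := hi (n + 1) (by omega)
    have h2 := hi (m + 1) (by omega)
    rw [sum_range_succ, mul_add, ← add_assoc, ih, prod_Ico_succ_top (by omega),
      prod_eq_prod_Ico_succ_bot (by omega : m < n)]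
    generalize ∏ k ∈ Ico (m + 1) n, ((1 - x ^ (k + 1)) * i (k + 1)) = G
    have e1 : x ^ ((m + 1) * (n + 2)) = x ^ ((m + 1) * (n + 1)) * x ^ (m + 1) := by
      rw [← pow_add]; ring_nf
    have e2 : x ^ ((m + 1 + 1) * (n + 1)) = x ^ ((m + 1) * (n + 1)) * x ^ (n + 1) := by
      rw [← pow_add]; ring_nf
    rw [e1, e2, pow_succ (-1 : R) (m + 1)]
    generalize x ^ ((m + 1) * (n + 1)) = Z
    generalize x ^ (m + 1) = a at *
    generalize x ^ (n + 1) = b at *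
    generalize i (m + 1) = j at *
    generalize i (n + 1) = l at *
    linear_combination (2 * (-1) ^ (m + 1) * Z * G * j) * h1 - (2 * (-1) ^ (m + 1) * Z * G * l * b) * h2

/-- A finite form of Gauss's identity `φ(-q) = ∏ (1 - q^k) / (1 + q^k)`. -/
theorem gauss_finite {R : Type*} [CommRing R] (x : R) (i : ℕ → R)
    (hi : ∀ k, 1 ≤ k → (1 + x ^ k) * i k = 1) (n : ℕ) :
    1 + 2 * ∑ s ∈ range n, (-1) ^ (s + 1) * x ^ ((s + 1) ^ 2)
      = ∏ k ∈ range n, ((1 - x ^ (k + 1)) * i (k + 1))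
        + 2 * ∑ s ∈ range n, (-1) ^ (s + 1) * i (s + 1) * (x ^ ((s + 1) * (n + 1)) *
            ∏ k ∈ Ico (s + 1) n, ((1 - x ^ (k + 1)) * i (k + 1))) := by
  induction n with
  | zero => simp
  | succ n ih =>
    -- At `m = n` only a multiple of `x ^ ((n+1)^2)` remains on the right; together with the new
    -- diagonal error term it gives the next square term, by `h1`.
    have h := gauss_telescope x i hi n n le_rfl
    have h1 := hi (n + 1) (by omega)
    simp only [mul_sub, sum_sub_distrib, Ico_self, prod_empty] at h
    rw [sum_range_succ, mul_add, ← add_assoc, ih, sum_range_succ (fun s => (-1) ^ (s + 1) *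
      i (s + 1) * (x ^ ((s + 1) * (n + 1 + 1)) *
            ∏ k ∈ Ico (s + 1) (n + 1), ((1 - x ^ (k + 1)) * i (k + 1))))]
    simp only [Ico_self, prod_empty]
    have e1 : x ^ ((n + 1) * (n + 1 + 1)) = x ^ ((n + 1) ^ 2) * x ^ (n + 1) := by
      rw [← pow_add]; ring_nf
    rw [← sq] at h
    rw [e1]
    linear_combination -h - (2 * (-1) ^ (n + 1) * x ^ ((n + 1) ^ 2)) * h1

end Gauss

/-! ### Coefficients of `φ(-q)` and its product formula -/

theorem coeff_phiNeg (n : ℕ) :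
    PowerSeries.coeff n phiNeg = (-1) ^ n * ({k : ℤ | k ^ 2 = (n : ℤ)}.ncard : ℤ) := by
  simp [phiNeg, ramanujanPhi, PowerSeries.coeff_rescale]

theorem coeff_phiNeg_of_not_sq (n : ℕ) (h : ∀ k : ℤ, k ^ 2 ≠ n) :
    PowerSeries.coeff n phiNeg = 0 := by
  rw [coeff_phiNeg]
  have : {k : ℤ | k ^ 2 = (n : ℤ)} = ∅ := by
    ext k; simp [h k]
  simp [this]

theorem coeff_phiNeg_sq (m : ℕ) (hm : m ≠ 0) :
    PowerSeries.coeff (m ^ 2) phiNeg = 2 * (-1) ^ m := by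
  rw [coeff_phiNeg]
  have : {k : ℤ | k ^ 2 = ((m ^ 2 : ℕ) : ℤ)} = {(m : ℤ), -(m : ℤ)} := by
    ext k; simp [sq_eq_sq_iff_eq_or_eq_neg]
  rw [this, Set.ncard_pair (by omega)]
  have : ((-1 : ℤ)) ^ (m ^ 2) = (-1) ^ m := by
    rcases Nat.even_or_odd m with h | h
    · rw [h.neg_one_pow, (h.pow_of_ne_zero two_ne_zero).neg_one_pow]
    · rw [h.neg_one_pow, h.pow.neg_one_pow]
  rw [this]; push_cast; ring

theorem X_pow_dvd_phiNeg_sub (n : ℕ) :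
    (PowerSeries.X : ℤ⟦X⟧) ^ (n + 1) ∣ phiNeg -
      (1 + 2 * ∑ s ∈ Finset.range n, (-1) ^ (s + 1) * PowerSeries.X ^ ((s + 1) ^ 2)) := by
  rw [PowerSeries.X_pow_dvd_iff]
  intro j hj
  have h2 : (2 : ℤ⟦X⟧) = PowerSeries.C 2 := by simp
  have h1 : ∀ s : ℕ, ((-1) ^ s : ℤ⟦X⟧) = PowerSeries.C ((-1) ^ s) := by intro s; simp
  simp only [map_sub, map_add, h2, h1, PowerSeries.coeff_C_mul, map_sum, PowerSeries.coeff_one,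
    PowerSeries.coeff_X_pow]
  by_cases hsq : ∃ k : ℤ, k ^ 2 = j
  · obtain ⟨k, hk⟩ := hsq
    have hj' : j = k.natAbs ^ 2 := by
      zify; rw [sq_abs, hk]
    generalize k.natAbs = m at hj'
    subst hj'
    rcases Nat.eq_zero_or_pos m with rfl | hm
    · rw [Finset.sum_eq_zero fun s _ => by rw [if_neg (by positivity), mul_zero]]
      simp [constantCoeff_phiNeg]
    · rw [coeff_phiNeg_sq m hm.ne', Finset.sum_eq_single (m - 1)]
      · rw [Nat.sub_add_cancel hm]; simp [hm.ne']
      · intro b _ hb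
        rw [if_neg, mul_zero]
        intro h
        have := Nat.pow_left_injective two_ne_zero h
        omega
      · intro h
        exfalso
        apply h
        rw [Finset.mem_range]
        nlinarith [Nat.sub_add_cancel hm, Nat.le_self_pow two_ne_zero m]
  · push Not at hsq
    rw [coeff_phiNeg_of_not_sq j hsq, Finset.sum_eq_zero, if_neg]
    · simp
    · rintro rfl; exact hsq 0 (by simp)
    · intro s _
      rw [if_neg, mul_zero]
      rintro rfl
      exact hsq (s + 1) (by push_cast; ring)

/-- Gauss's product formula `φ(-q) ∏ (1 + q^k) = ∏ (1 - q^k)`, truncated. -/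
theorem X_pow_dvd_gauss (n : ℕ) :
    (PowerSeries.X : ℤ⟦X⟧) ^ (n + 1) ∣
      phiNeg * ∏ k ∈ Finset.range n, (1 + PowerSeries.X ^ (k + 1))
        - ∏ k ∈ Finset.range n, (1 - PowerSeries.X ^ (k + 1)) := by
  let i : ℕ → ℤ⟦X⟧ := fun k => PowerSeries.invOfUnit (1 + PowerSeries.X ^ k) 1
  have hi : ∀ k, 1 ≤ k → (1 + PowerSeries.X ^ k) * i k = 1 := by
    intro k hk
    refine PowerSeries.mul_invOfUnit _ _ ?_
    simp [show k ≠ 0 by omega]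
  have h1 := X_pow_dvd_phiNeg_sub n
  rw [gauss_finite PowerSeries.X i hi n] at h1
  have h2 : (PowerSeries.X : ℤ⟦X⟧) ^ (n + 1) ∣ phiNeg -
      ∏ k ∈ Finset.range n, ((1 - PowerSeries.X ^ (k + 1)) * i (k + 1)) := by
    -- Each error term of `gauss_finite` contains `X ^ ((s+1)(n+1))`.
    rw [← sub_sub] at h1
    refine (dvd_sub_left (Dvd.dvd.mul_left (Finset.dvd_sum fun s _ => ?_) _)).mp h1
    refine Dvd.dvd.mul_left (Dvd.dvd.mul_right (pow_dvd_pow _ ?_) _) _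
    nlinarith
  have h3 := h2.mul_right (∏ k ∈ Finset.range n, (1 + PowerSeries.X ^ (k + 1)))
  rw [sub_mul, ← Finset.prod_mul_distrib] at h3
  convert h3 using 2
  refine Finset.prod_congr rfl fun k _ => ?_
  linear_combination -(1 - PowerSeries.X ^ (k + 1)) * hi (k + 1) (by omega)

/-! ### Norm over cube roots of unity -/

section Norm

open Finset PowerSeries

/-- A square divisible by `3` is divisible by `9`, and `(-1)^(9m) = (-1)^m`. -/
theorem coeff_expand_expand_phiNeg (n : ℕ) (hn : 3 ∣ n) :
    coeff n (expand 3 three_ne_zero phiNegCube) = coeff n phiNeg := by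
  obtain ⟨m, rfl⟩ := hn
  rw [coeff_expand_mul, phiNegCube]
  by_cases h : 3 ∣ m
  · obtain ⟨m, rfl⟩ := h
    rw [coeff_expand_mul, coeff_phiNeg, coeff_phiNeg]
    have h1 : {k : ℤ | k ^ 2 = ((3 * (3 * m) : ℕ) : ℤ)} =
        (fun k : ℤ => 3 * k) '' {k : ℤ | k ^ 2 = (m : ℤ)} := by
      ext k
      simp only [Set.mem_ofPred_eq, Set.mem_image]
      push_cast
      constructor
      · intro hk
        have h3 : (3 : ℤ) ∣ k :=
          Int.prime_three.dvd_of_dvd_pow (n := 2) (by rw [hk]; exact Dvd.intro _ rfl)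
        obtain ⟨l, rfl⟩ := h3
        exact ⟨l, by linarith, rfl⟩
      · rintro ⟨l, hl, rfl⟩
        linarith
    rw [h1, Set.ncard_image_of_injective _ (fun a b hab => by simpa using hab)]
    congr 1
    rw [← mul_assoc, pow_mul]
    norm_num
  · rw [coeff_expand_of_not_dvd _ _ _ h, coeff_phiNeg_of_not_sq]
    intro k hk
    push_cast at hk
    have h3 : (3 : ℤ) ∣ k :=
      Int.prime_three.dvd_of_dvd_pow (n := 2) (by rw [hk]; exact Dvd.intro _ rfl)
    obtain ⟨l, rfl⟩ := h3
    apply h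
    zify
    exact ⟨l ^ 2, by linarith⟩

/-- The part of `φ(-q)` away from exponents divisible by `3` lives on exponents `1` mod `3`. -/
theorem coeff_expand_expand_sub_phiNeg (n : ℕ) (hn : n % 3 ≠ 1) :
    coeff n (expand 3 three_ne_zero phiNegCube - phiNeg) = 0 := by
  by_cases h : 3 ∣ n
  · rw [map_sub, coeff_expand_expand_phiNeg n h, sub_self]
  · rw [map_sub, coeff_expand_of_not_dvd _ _ _ h, coeff_phiNeg_of_not_sq, sub_zero]
    intro k hk
    have : (k ^ 2) % 3 = 2 := by rw [hk]; omega
    rcases (by omega : k % 3 = 0 ∨ k % 3 = 1 ∨ k % 3 = 2) with h | h | h <;>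
      simp [sq, Int.mul_emod, h] at this

theorem X_pow_dvd_expand {R : Type*} [CommRing R] {f : R⟦X⟧} {n : ℕ} (h : X ^ n ∣ f) :
    X ^ n ∣ expand 3 three_ne_zero f := by
  have := map_dvd (expand 3 three_ne_zero) h
  rw [map_pow, expand_X, ← pow_mul] at this
  exact (pow_dvd_pow _ (by omega)).trans this

theorem X_pow_dvd_rescale {R : Type*} [CommRing R] (a : R) {f : R⟦X⟧} {n : ℕ} (h : X ^ n ∣ f) :
    X ^ n ∣ rescale a f := by
  rw [X_pow_dvd_iff] at h ⊢
  intro m hm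
  rw [coeff_rescale, h m hm, mul_zero]

theorem mk_eq_of_dvd {R : Type*} [CommRing R] {d f g : R} (h : d ∣ f - g) :
    Ideal.Quotient.mk (Ideal.span {d}) f = Ideal.Quotient.mk (Ideal.span {d}) g :=
  Ideal.Quotient.eq.mpr (Ideal.mem_span_singleton.mpr h)

/-- The norm over cube roots of unity of a truncated product `∏ (1 + c q^k)` with `c ^ 3 = c`. -/
theorem prod_norm_cube {R : Type*} [CommRing R] (x w c : R) (hw : w ^ 2 + w + 1 = 0)
    (hc : c ^ 3 = c) (N : ℕ) :
    (∏ k ∈ range (3 * N), (1 + c * x ^ (k + 1))) *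
      (∏ k ∈ range (3 * N), (1 + c * (w * x) ^ (k + 1))) *
      (∏ k ∈ range (3 * N), (1 + c * (w ^ 2 * x) ^ (k + 1))) *
      (∏ k ∈ range N, (1 + c * (x ^ 9) ^ (k + 1))) =
    (∏ k ∈ range (3 * N), (1 + c * (x ^ 3) ^ (k + 1))) *
      (∏ k ∈ range N, (1 + c * (x ^ 3) ^ (k + 1))) ^ 3 := by
  have w3 : w ^ 3 = 1 := by linear_combination (w - 1) * hw
  have w3N : w ^ (3 * N) = 1 := by rw [pow_mul, w3, one_pow]
  -- Handles exponents prime to `3`. At multiples of `3` the conjugate factors coincide and give a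
  -- cube, while the `x ^ 9` product supplies the factors missing from the `x ^ 3` product.
  have key : ∀ t : R, (1 + c * t) * (1 + c * (w * t)) * (1 + c * (w ^ 2 * t)) = 1 + c * t ^ 3 := by
    intro t
    linear_combination (c * t + c ^ 2 * t ^ 2 * w) * hw + t ^ 3 * hc + c ^ 3 * t ^ 3 * w3
  induction N with
  | zero => simp
  | succ N ih =>
    have w3N : w ^ (3 * N) = 1 := by rw [pow_mul, w3, one_pow]
    have ih := ih w3N
    have k1 := key (x ^ (3 * N + 1))
    have k2 := key (x ^ (3 * N + 2))
    rw [show 3 * (N + 1) = 3 * N + 1 + 1 + 1 by ring]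
    simp only [prod_range_succ]
    generalize (∏ k ∈ range (3 * N), (1 + c * x ^ (k + 1))) = a1 at *
    generalize (∏ k ∈ range (3 * N), (1 + c * (w * x) ^ (k + 1))) = a2 at *
    generalize (∏ k ∈ range (3 * N), (1 + c * (w ^ 2 * x) ^ (k + 1))) = a3 at *
    generalize (∏ k ∈ range N, (1 + c * (x ^ 9) ^ (k + 1))) = a4 at *
    generalize (∏ k ∈ range (3 * N), (1 + c * (x ^ 3) ^ (k + 1))) = a5 at *
    generalize (∏ k ∈ range N, (1 + c * (x ^ 3) ^ (k + 1))) = a6 at *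
    have p1 : (w * x) ^ (3 * N + 1) = w * x ^ (3 * N + 1) := by
      rw [mul_pow, pow_succ w, w3N, one_mul]
    have p2 : (w * x) ^ (3 * N + 1 + 1) = w ^ 2 * x ^ (3 * N + 2) := by
      rw [mul_pow, pow_succ w, pow_succ w, w3N]; ring
    have p3 : (w * x) ^ (3 * N + 1 + 1 + 1) = x ^ (3 * N + 3) := by
      rw [mul_pow, pow_succ w, pow_succ w, pow_succ w, w3N]; linear_combination x ^ (3 * N + 3) * w3
    have q1 : (w ^ 2 * x) ^ (3 * N + 1) = w ^ 2 * x ^ (3 * N + 1) := by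
      rw [mul_pow, ← pow_mul, mul_comm 2, pow_mul, pow_succ w, w3N, one_mul]
    have q2 : (w ^ 2 * x) ^ (3 * N + 1 + 1) = w * x ^ (3 * N + 2) := by
      rw [mul_pow, ← pow_mul, mul_comm 2, pow_mul, pow_succ w, pow_succ w, w3N]
      linear_combination w * x ^ (3 * N + 2) * w3
    have q3 : (w ^ 2 * x) ^ (3 * N + 1 + 1 + 1) = x ^ (3 * N + 3) := by
      rw [mul_pow, ← pow_mul, mul_comm 2, pow_mul, pow_succ w, pow_succ w, pow_succ w, w3N]
      linear_combination (w ^ 3 + 1) * x ^ (3 * N + 3) * w3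
    have r1 : (x ^ 3) ^ (3 * N + 1) = (x ^ (3 * N + 1)) ^ 3 := by ring
    have r2 : (x ^ 3) ^ (3 * N + 1 + 1) = (x ^ (3 * N + 2)) ^ 3 := by ring
    have r3 : (x ^ 3) ^ (3 * N + 1 + 1 + 1) = (x ^ 9) ^ (N + 1) := by ring
    have r4 : (x ^ 3) ^ (N + 1) = x ^ (3 * N + 3) := by ring
    rw [p1, p2, p3, q1, q2, q3, r1, r2, r3, r4, ← k1, ← k2]
    linear_combination ((1 + c * x ^ (3 * N + 1)) * (1 + c * (w * x ^ (3 * N + 1))) *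
      (1 + c * (w ^ 2 * x ^ (3 * N + 1))) * ((1 + c * x ^ (3 * N + 2)) *
      (1 + c * (w * x ^ (3 * N + 2))) * (1 + c * (w ^ 2 * x ^ (3 * N + 2)))) *
      (1 + c * x ^ (3 * N + 3)) ^ 3 * (1 + c * (x ^ 9) ^ (N + 1))) * ih

/-- Multiplying the congruences for the conjugates of `φ(-q)` together. -/
theorem norm_cancel {R S : Type*} [CommRing R] [CommRing S] {π : R →+* S}
    {f₀ f₁ f₂ a t p₀ p₁ p₂ p₉ e d m₀ m₁ m₂ m₉ e' d' : R}
    (h₀ : π (f₀ * p₀) = π m₀) (h₁ : π (f₁ * p₁) = π m₁) (h₂ : π (f₂ * p₂) = π m₂)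
    (h₉ : π (a * p₉) = π m₉) (he : π (t * e) = π e') (hd : π (t * d) = π d')
    (hp : p₀ * p₁ * p₂ * p₉ = e * d ^ 3) (hm : m₀ * m₁ * m₂ * m₉ = e' * d' ^ 3) :
    π (a * (f₀ * f₁ * f₂) * (e * d ^ 3)) = π (t ^ 4 * (e * d ^ 3)) := by
  calc π (a * (f₀ * f₁ * f₂) * (e * d ^ 3))
      = π (f₀ * p₀) * π (f₁ * p₁) * π (f₂ * p₂) * π (a * p₉) := by
        rw [← hp]; simp only [← map_mul]; congr 1; ring
    _ = π (t * e) * π (t * d) ^ 3 := by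
        rw [h₀, h₁, h₂, h₉, he, hd]; simp only [← map_mul, ← map_pow]; rw [hm]
    _ = _ := by simp only [← map_mul, ← map_pow]; congr 1; ring

theorem exists_cube_root : ∃ w : ℂ, w ^ 2 + w + 1 = 0 := by
  obtain ⟨w, hw⟩ := IsAlgClosed.exists_root (Polynomial.X ^ 2 + Polynomial.X + 1 : Polynomial ℂ)
    (by
      have : (Polynomial.X ^ 2 + Polynomial.X + 1 : Polynomial ℂ).degree = 2 := by compute_degree!
      rw [this]; norm_num)
  exact ⟨w, by simpa using hw⟩

/-- `φ(-q^9) (φ(-q^9)^3 - w^3) = φ(-q^3)^4` where `w = φ(-q^9) - φ(-q)`, over `ℂ`. -/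
theorem map_phiNeg_cubic :
    let ψ := PowerSeries.map (Int.castRingHom ℂ)
    ψ (expand 3 three_ne_zero phiNegCube) * (ψ (expand 3 three_ne_zero phiNegCube) ^ 3
      - ψ (expand 3 three_ne_zero phiNegCube - phiNeg) ^ 3) = ψ phiNegCube ^ 4 := by
  intro ψ
  obtain ⟨w, hw⟩ := exists_cube_root
  have w3 : w ^ 3 = 1 := by linear_combination (w - 1) * hw
  have hCw : (C w : ℂ⟦X⟧) ^ 2 + C w + 1 = 0 := by
    rw [← map_pow, ← map_add, ← map_one C, ← map_add, hw, map_zero]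
  set A := expand 3 three_ne_zero phiNegCube with hA
  have hAr : ∀ z : ℂ, z ^ 3 = 1 → rescale z (ψ A) = ψ A := by
    intro z hz
    ext n
    rw [coeff_rescale, coeff_map]
    by_cases h : 3 ∣ n
    · obtain ⟨m, rfl⟩ := h
      rw [pow_mul, hz, one_pow, one_mul]
    · rw [hA, coeff_expand_of_not_dvd _ _ _ h]; simp
  have hWr : ∀ z : ℂ, z ^ 3 = 1 → rescale z (ψ (A - phiNeg)) = C z * ψ (A - phiNeg) := by
    intro z hz
    ext n
    rw [coeff_rescale, coeff_C_mul, coeff_map]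
    by_cases h : n % 3 = 1
    · rw [← Nat.div_add_mod n 3, h, pow_succ, pow_mul, hz, one_pow, one_mul]
    · rw [coeff_expand_expand_sub_phiNeg n h]; simp
  have hphi : ∀ z : ℂ, z ^ 3 = 1 →
      rescale z (ψ phiNeg) = ψ A - C z * ψ (A - phiNeg) := by
    intro z hz
    rw [← hWr z hz, show ψ phiNeg = ψ A - ψ (A - phiNeg) by rw [map_sub]; ring, map_sub, hAr z hz]
  rw [← sub_eq_zero]
  ext N
  rw [map_zero]
  revert N
  suffices h : ∀ N, X ^ N ∣ ψ A * (ψ A ^ 3 - ψ (A - phiNeg) ^ 3) - ψ phiNegCube ^ 4 by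
    intro N
    exact X_pow_dvd_iff.mp (h (N + 1)) N (by omega)
  intro N
  set p : ℂ → ℕ → ℂ⟦X⟧ → ℂ⟦X⟧ := fun c n x => ∏ k ∈ range n, (1 + C c * x ^ (k + 1)) with hp
  have hG : ∀ n, N ≤ n → X ^ N ∣ ψ phiNeg * p 1 n X - p (-1) n X := by
    intro n hn
    have := map_dvd ψ (X_pow_dvd_gauss n)
    simp only [ψ, map_pow, map_X, map_sub, map_mul, map_prod, map_add, map_one] at this
    refine (pow_dvd_pow _ (by omega)).trans (this.trans (dvd_of_eq ?_))
    simp [hp, ψ, sub_eq_add_neg]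
  have hpr : ∀ z c n, rescale z (p c n X) = p c n (C z * X) := by
    intro z c n
    have hC : rescale z (C c : ℂ⟦X⟧) = C c := by
      ext m
      rw [coeff_rescale, coeff_C]
      split_ifs with h <;> simp [h]
    simp [hp, map_prod, rescale_X, hC]
  have hpe : ∀ c n (m : ℕ), expand 3 three_ne_zero (p c n (X ^ m)) = p c n ((X ^ m) ^ 3) := by
    intro c n m
    simp only [hp, map_prod, map_add, map_mul, map_pow, expand_X, expand_C, map_one]
    refine prod_congr rfl fun k _ => ?_
    ring
  -- Modulo `X ^ N` finite products replace the infinite ones.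
  set π := Ideal.Quotient.mk (Ideal.span {(X : ℂ⟦X⟧) ^ N})
  have g0 : π (ψ phiNeg * p 1 (3 * N) X) = π (p (-1) (3 * N) X) :=
    mk_eq_of_dvd (hG (3 * N) (by omega))
  have g1 : ∀ z : ℂ, π (rescale z (ψ phiNeg) * p 1 (3 * N) (C z * X))
      = π (p (-1) (3 * N) (C z * X)) := by
    intro z
    refine mk_eq_of_dvd ?_
    rw [← hpr, ← hpr, ← map_mul, ← map_sub]
    exact X_pow_dvd_rescale _ (hG (3 * N) (by omega))
  have hc3 : ψ phiNegCube = expand 3 three_ne_zero (ψ phiNeg) := by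
    simp only [ψ, phiNegCube, map_expand]
  have hc9 : ψ A = expand 3 three_ne_zero (ψ phiNegCube) := by
    simp only [ψ, hA, map_expand]
  have d3 : ∀ n, N ≤ n → X ^ N ∣ ψ phiNegCube * p 1 n (X ^ 3) - p (-1) n (X ^ 3) := by
    intro n hn
    have := X_pow_dvd_expand (hG n hn)
    rw [map_sub, map_mul] at this
    have e := fun c => hpe c n 1
    simp only [pow_one] at e
    rwa [e, e, ← hc3] at this
  have d9 : X ^ N ∣ ψ A * p 1 N (X ^ 9) - p (-1) N (X ^ 9) := by
    have := X_pow_dvd_expand (d3 N le_rfl)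
    rwa [map_sub, map_mul, hpe, hpe, ← hc9, ← pow_mul] at this
  have g3 : ∀ n, N ≤ n → π (ψ phiNegCube * p 1 n (X ^ 3)) = π (p (-1) n (X ^ 3)) :=
    fun n hn => mk_eq_of_dvd (d3 n hn)
  have g9 : π (ψ A * p 1 N (X ^ 9)) = π (p (-1) N (X ^ 9)) := mk_eq_of_dvd d9
  have hn : ψ A ^ 3 - ψ (A - phiNeg) ^ 3 =
      ψ phiNeg * rescale w (ψ phiNeg) * rescale (w ^ 2) (ψ phiNeg) := by
    rw [hphi w w3, hphi (w ^ 2) (by rw [← pow_mul, mul_comm, pow_mul, w3, one_pow]),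
      show ψ phiNeg = ψ A - ψ (A - phiNeg) by rw [map_sub]; ring, map_pow]
    generalize ψ A = a
    generalize ψ (A - phiNeg) = b
    generalize (C w : ℂ⟦X⟧) = v at *
    linear_combination (a ^ 2 * b - v * a * b ^ 2 + (v - 1) * b ^ 3) * hCw
  have q1 := prod_norm_cube X (C w) (C (1 : ℂ)) hCw (by simp) N
  have q2 := prod_norm_cube X (C w) (C (-1 : ℂ)) hCw (by rw [← map_pow]; norm_num) N
  have fin := norm_cancel g0 (g1 w) (g1 (w ^ 2)) g9 (g3 (3 * N) (by omega)) (g3 N le_rfl)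
    (by rw [map_pow C]; exact q1) (by rw [map_pow C]; exact q2)
  rw [← hn] at fin
  have fin2 := Ideal.mem_span_singleton.mp (Ideal.Quotient.eq.mp fin)
  rw [← sub_mul] at fin2
  -- The common factor has constant term `1`, so it cancels.
  have hu : IsUnit (p 1 (3 * N) (X ^ 3) * p 1 N (X ^ 3) ^ 3) := by
    rw [isUnit_iff_constantCoeff]
    simp [hp, map_prod]
  exact hu.dvd_mul_right.mp fin2

/-- The cubic relation between `φ(-q)`, `φ(-q^3)` and `φ(-q^9)`. -/
theorem phiNeg_cubic :
    expand 3 three_ne_zero phiNegCube * (3 * expand 3 three_ne_zero phiNegCube ^ 2 * phiNeg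
      - 3 * expand 3 three_ne_zero phiNegCube * phiNeg ^ 2 + phiNeg ^ 3) = phiNegCube ^ 4 := by
  have h := map_phiNeg_cubic
  simp only [← map_pow (PowerSeries.map _), ← map_sub, ← map_mul] at h
  have h' := PowerSeries.map_injective (Int.castRingHom ℂ) Int.cast_injective h
  rw [← h']
  ring

end Norm

/-! ### The operator `U` and the modular equation -/

section Trisection

open PowerSeries

/-- The operator `∑ a(n) q^n ↦ ∑ a(3n) q^n`. -/
noncomputable def trisect : ℤ⟦X⟧ →+ ℤ⟦X⟧ where
  toFun f := mk fun n => coeff (3 * n) f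
  map_zero' := by ext; simp
  map_add' f g := by ext; simp

theorem coeff_trisect (f : ℤ⟦X⟧) (n : ℕ) : coeff n (trisect f) = coeff (3 * n) f := by
  simp [trisect]

/-- This linearity turns an algebraic equation over series in `q^3` into a recurrence for values of
`U`. -/
theorem trisect_expand_mul (f g : ℤ⟦X⟧) :
    trisect (expand 3 three_ne_zero f * g) = f * trisect g := by
  ext n
  rw [coeff_trisect, coeff_mul, coeff_mul]
  symm
  refine Finset.sum_of_injOn (fun x => (3 * x.1, 3 * x.2)) ?_ ?_ ?_ ?_
  · rintro ⟨a, b⟩ _ ⟨c, d⟩ _ h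
    simp only [Prod.mk.injEq] at h ⊢
    omega
  · rintro ⟨a, b⟩ h
    simp only [Finset.mem_coe, Finset.HasAntidiagonal.mem_antidiagonal] at h ⊢
    omega
  · rintro ⟨a, b⟩ h h'
    rw [Finset.HasAntidiagonal.mem_antidiagonal] at h
    simp only at h
    rw [coeff_expand_of_not_dvd, zero_mul]
    rintro ⟨c, rfl⟩
    refine h' ⟨(c, n - c), ?_, ?_⟩
    · simp only [Finset.mem_coe, Finset.HasAntidiagonal.mem_antidiagonal]
      omega
    · simp only [Prod.mk.injEq, true_and]
      omega
  · rintro ⟨a, b⟩ _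
    rw [coeff_expand_mul, coeff_trisect]

theorem trisect_expand (f : ℤ⟦X⟧) : trisect (expand 3 three_ne_zero f) = f := by
  ext n
  rw [coeff_trisect, coeff_expand_mul]

theorem coeff_iterate_trisect (f : ℤ⟦X⟧) (k n : ℕ) :
    coeff n (trisect^[k] f) = coeff (3 ^ k * n) f := by
  induction k generalizing n with
  | zero => simp
  | succ k ih => rw [Function.iterate_succ_apply', coeff_trisect, ih, ← mul_assoc, ← pow_succ]

theorem trisect_phiNeg : trisect phiNeg = phiNegCube := by
  rw [← trisect_expand phiNegCube]
  ext n
  rw [coeff_trisect, coeff_trisect, coeff_expand_expand_phiNeg _ (Dvd.intro _ rfl)]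

theorem trisect_eq_zero_of_sq {f : ℤ⟦X⟧} (h : ∀ n, n % 3 ≠ 1 → coeff n f = 0) :
    trisect (f ^ 2) = 0 := by
  ext n
  rw [coeff_trisect, sq, coeff_mul, map_zero]
  refine Finset.sum_eq_zero ?_
  rintro ⟨a, b⟩ hab
  rw [Finset.HasAntidiagonal.mem_antidiagonal] at hab
  simp only at hab ⊢
  by_cases ha : a % 3 = 1
  · rw [h b (by omega), mul_zero]
  · rw [h a ha, zero_mul]

theorem trisect_phiNeg_sq : trisect (phiNeg ^ 2) = phiNegCube ^ 2 := by
  set A := expand 3 three_ne_zero phiNegCube with hA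
  have h := trisect_eq_zero_of_sq coeff_expand_expand_sub_phiNeg
  -- The left side lives on exponents `2` mod `3`, so `U` kills it.
  have e : (A - phiNeg) ^ 2 = phiNeg ^ 2 + expand 3 three_ne_zero phiNegCube * A
      - (expand 3 three_ne_zero phiNegCube * phiNeg + expand 3 three_ne_zero phiNegCube * phiNeg) := by
    rw [← hA]; ring
  rw [← hA, e, map_sub, map_add, map_add, trisect_expand_mul, trisect_expand_mul, trisect_phiNeg,
    hA, trisect_expand] at h
  linear_combination h

theorem phiNeg_ne_zero : phiNeg ≠ 0 := by
  intro h
  have := constantCoeff_phiNeg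
  simp [h] at this

theorem constantCoeff_ph3Series : constantCoeff ph3Series = 1 := by
  have h := congrArg constantCoeff ph3Series_mul_phiNeg
  simpa [phiNegCube, constantCoeff_phiNeg, constantCoeff_expand] using h

theorem ph3Series_ne_zero : ph3Series ≠ 0 := by
  intro h
  have := constantCoeff_ph3Series
  simp [h] at this

theorem expand_ph3Series_mul :
    expand 3 three_ne_zero ph3Series * phiNegCube = expand 3 three_ne_zero phiNegCube := by
  rw [← ph3Series_mul_phiNeg, map_mul, ph3Series_mul_phiNeg, phiNegCube]

/-- The modular equation of degree `3`. -/
theorem ph3Series_cubic : ph3Series ^ 3 = 3 * expand 3 three_ne_zero ph3Series ^ 3 * ph3Series ^ 2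
    - 3 * expand 3 three_ne_zero ph3Series ^ 2 * ph3Series + expand 3 three_ne_zero ph3Series := by
  have h := phiNeg_cubic
  rw [← expand_ph3Series_mul, ← ph3Series_mul_phiNeg] at h
  have hP := ph3Series_ne_zero
  have hφ := phiNeg_ne_zero
  have h2 : ph3Series * phiNeg ^ 4 ≠ 0 := mul_ne_zero hP (pow_ne_zero _ hφ)
  apply mul_left_cancel₀ h2
  linear_combination -h

theorem trisect_recurrence (n : ℕ) : trisect (ph3Series ^ (n + 3)) =
    3 * ph3Series ^ 3 * trisect (ph3Series ^ (n + 2))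
    - 3 * ph3Series ^ 2 * trisect (ph3Series ^ (n + 1)) + ph3Series * trisect (ph3Series ^ n) := by
  simp only [← trisect_expand_mul, ← map_add, ← map_sub, map_mul, map_pow, map_ofNat]
  congr 1
  linear_combination ph3Series ^ n * ph3Series_cubic

theorem trisect_ph3Series_and_sq : trisect ph3Series = ph3Series ^ 3 ∧
    trisect (ph3Series ^ 2) = 3 * ph3Series ^ 6 - 2 * ph3Series ^ 2 := by
  obtain ⟨v, hv⟩ : ∃ v, phiNeg * v = 1 := ⟨_, PowerSeries.mul_invOfUnit phiNeg 1 constantCoeff_phiNeg⟩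
  have hvE : phiNegCube * expand 3 three_ne_zero v = 1 := by
    rw [phiNegCube, ← map_mul, hv, map_one]
  have hP : phiNegCube * v = ph3Series := by
    rw [← ph3Series_mul_phiNeg, mul_assoc, hv, mul_one]
  set z := expand 3 three_ne_zero v * phiNeg with hz
  -- `U` is easy on `z = 1/P` and `z^2`; dividing the cubic by `P^2` and by `P` expresses `P` and
  -- `P^2` through them.
  have hzP : ph3Series * z = 1 := by
    rw [← hvE, ← ph3Series_mul_phiNeg]; ring
  have hz1 : trisect z = ph3Series := by
    rw [hz, trisect_expand_mul, trisect_phiNeg, mul_comm, hP]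
  have hz2 : trisect (z ^ 2) = ph3Series ^ 2 := by
    rw [hz, mul_pow, ← map_pow, trisect_expand_mul, trisect_phiNeg_sq, ← hP]; ring
  have h1 : trisect 1 = 1 := by
    conv_lhs => rw [← map_one (expand 3 three_ne_zero), trisect_expand]
  have hc := ph3Series_cubic
  set P := ph3Series
  set Q := expand 3 three_ne_zero P with hQ
  have e1 : P = 3 * Q ^ 3 * 1 - 3 * Q ^ 2 * z + Q * z ^ 2 := by
    linear_combination z ^ 2 * hc - (P ^ 2 * z + P - 3 * Q ^ 3 * (P * z + 1) + 3 * Q ^ 2 * z) * hzP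
  have e2 : P ^ 2 = 3 * Q ^ 3 * P - 3 * Q ^ 2 * 1 + Q * z := by
    linear_combination z * hc - (P ^ 2 - 3 * Q ^ 3 * P + 3 * Q ^ 2) * hzP
  have E : ∀ a b c : ℤ⟦X⟧, trisect (3 * Q ^ 3 * a - 3 * Q ^ 2 * b + Q * c)
      = 3 * P ^ 3 * trisect a - 3 * P ^ 2 * trisect b + P * trisect c := by
    intro a b c
    simp only [← trisect_expand_mul, ← map_add, ← map_sub, map_mul, map_pow, map_ofNat, ← hQ]
  have t1 : trisect P = P ^ 3 := by
    conv_lhs => rw [e1]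
    rw [E, h1, hz1, hz2]; ring
  refine ⟨t1, ?_⟩
  conv_lhs => rw [e2]
  rw [E, h1, hz1, t1]; ring

end Trisection

/-! ### Weights of polynomials in `s` -/

section Filtration

/-- `3`-adic filtration of `ℤ[s]`: combinations of the `3 ^ v * s ^ j` with `3 j + c ≤ 2 v`. -/
def wt {R : Type*} [CommRing R] (s : R) (c : ℤ) : AddSubgroup R :=
  AddSubgroup.closure {x | ∃ v j : ℕ, 3 * (j : ℤ) + c ≤ 2 * v ∧ x = 3 ^ v * s ^ j}

/-- The part of `wt` without constant term. -/
def wtPos {R : Type*} [CommRing R] (s : R) (c : ℤ) : AddSubgroup R :=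
  AddSubgroup.closure {x | ∃ v j : ℕ, 1 ≤ j ∧ 3 * (j : ℤ) + c ≤ 2 * v ∧ x = 3 ^ v * s ^ j}

variable {R : Type*} [CommRing R] {s : R}

theorem wtPos_le_wt (c : ℤ) : wtPos s c ≤ wt s c :=
  AddSubgroup.closure_mono fun _ ⟨v, j, _, h, hx⟩ => ⟨v, j, h, hx⟩

theorem wtPos_anti {c d : ℤ} (h : d ≤ c) : wtPos s c ≤ wtPos s d :=
  AddSubgroup.closure_mono fun _ ⟨v, j, hj, h', hx⟩ => ⟨v, j, hj, by omega, hx⟩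

theorem mul_pow_mem_wt {c : ℤ} (a : ℤ) (v j : ℕ) (h : 3 * (j : ℤ) + c ≤ 2 * v) :
    (a : R) * (3 ^ v * s ^ j) ∈ wt s c := by
  rw [← zsmul_eq_mul]
  refine AddSubgroup.zsmul_mem _ ?_ a
  exact AddSubgroup.subset_closure ⟨v, j, h, rfl⟩

theorem mul_pow_mem_wtPos {c : ℤ} (a : ℤ) (v j : ℕ) (hj : 1 ≤ j)
    (h : 3 * (j : ℤ) + c ≤ 2 * v) : (a : R) * (3 ^ v * s ^ j) ∈ wtPos s c := by
  rw [← zsmul_eq_mul]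
  refine AddSubgroup.zsmul_mem _ ?_ a
  exact AddSubgroup.subset_closure ⟨v, j, hj, h, rfl⟩

theorem wtPos_mul_wt {c d : ℤ} {x y : R} (hx : x ∈ wtPos s c) (hy : y ∈ wt s d) :
    x * y ∈ wtPos s (c + d) := by
  induction hx using AddSubgroup.closure_induction with
  | zero => simp
  | add a b _ _ ha hb => rw [add_mul]; exact add_mem ha hb
  | neg a _ ha => rw [neg_mul]; exact neg_mem ha
  | mem a ha =>
    obtain ⟨v, j, hj, hv, rfl⟩ := ha
    induction hy using AddSubgroup.closure_induction with
    | zero => simp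
    | add a b _ _ ha hb => rw [mul_add]; exact add_mem ha hb
    | neg a _ ha => rw [mul_neg]; exact neg_mem ha
    | mem b hb =>
      obtain ⟨w, i, hw, rfl⟩ := hb
      exact AddSubgroup.subset_closure ⟨v + w, j + i, by omega, by push_cast; omega, by ring⟩

/-- As `j ≥ 1`, `2v ≥ 2m + 3`, and parity gives `v ≥ m + 2`. -/
theorem dvd_of_mem_wtPos {m : ℕ} {x : R} (hx : x ∈ wtPos s (2 * m)) : 3 ^ (m + 2) ∣ x := by
  induction hx using AddSubgroup.closure_induction with
  | zero => simp
  | add a b _ _ ha hb => exact dvd_add ha hb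
  | neg a _ ha => exact ha.neg_right
  | mem a ha =>
    obtain ⟨v, j, hj, hv, rfl⟩ := ha
    exact (pow_dvd_pow 3 (by omega)).mul_right _

/-- To see that `T (p * ·)` maps `wtPos s c` into `q * wtPos s d`, it suffices to check it on the
generators `3 ^ v * s ^ k`. -/
theorem map_mem_wtPos (T : R →+ R) (p q : R) (c d : ℤ)
    (hT : ∀ v k : ℕ, 1 ≤ k → 3 * (k : ℤ) + c ≤ 2 * v → ∃ r ∈ wtPos s (d - 2 * v),
      T (p * s ^ k) = q * r) {x : R} (hx : x ∈ wtPos s c) :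
    ∃ y ∈ wtPos s d, T (p * x) = q * y := by
  induction hx using AddSubgroup.closure_induction with
  | zero => exact ⟨0, zero_mem _, by simp⟩
  | add a b _ _ ha hb =>
    obtain ⟨y, hy, ha⟩ := ha
    obtain ⟨z, hz, hb⟩ := hb
    exact ⟨y + z, add_mem hy hz, by rw [mul_add, map_add, ha, hb, mul_add]⟩
  | neg a _ ha =>
    obtain ⟨y, hy, ha⟩ := ha
    exact ⟨-y, neg_mem hy, by rw [mul_neg, map_neg, ha, mul_neg]⟩
  | mem a ha =>
    obtain ⟨v, k, hk, hv, rfl⟩ := ha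
    obtain ⟨r, hr, h⟩ := hT v k hk hv
    refine ⟨r * ((1 : ℤ) * (3 ^ v * s ^ 0)), ?_, ?_⟩
    · have := wtPos_mul_wt hr (mul_pow_mem_wt (s := s) (c := 2 * v) 1 v 0 (by simp))
      rwa [sub_add_cancel] at this
    · have e : p * (3 ^ v * s ^ k) = (3 ^ v : ℕ) • (p * s ^ k) := by
        rw [nsmul_eq_mul]; push_cast; ring
      rw [e, map_nsmul, h, nsmul_eq_mul]; push_cast; ring

end Filtration

/-! ### Weight bounds for `U` and iteration -/

section Recurrence

local notation "P" => ph3Series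

local notation "𝔰" => ph3Series ^ 4 - 1

theorem trisect_pow_recurrence (i k : ℕ) : trisect (P ^ i * 𝔰 ^ (k + 3)) =
    (57 * 𝔰 + 135 * 𝔰 ^ 2 + 81 * 𝔰 ^ 3) * trisect (P ^ i * 𝔰 ^ (k + 2))
    + (120 * 𝔰 + 279 * 𝔰 ^ 2 + 162 * 𝔰 ^ 3) * trisect (P ^ i * 𝔰 ^ (k + 1))
    + (64 * 𝔰 + 144 * 𝔰 ^ 2 + 81 * 𝔰 ^ 3) * trisect (P ^ i * 𝔰 ^ k) := by
  simp only [← trisect_expand_mul, ← map_add]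
  congr 1
  simp only [map_add, map_mul, map_pow, map_ofNat, map_sub, map_one]
  have hc := ph3Series_cubic
  generalize PowerSeries.expand 3 three_ne_zero P = Q at *
  generalize P = y at *
  -- The cubic equation of `P^4 - 1` over `ℤ[P(q^3)^4]`, a multiple of the modular equation.
  have key : (y ^ 4 - 1) ^ 3 =
    (57 * (Q ^ 4 - 1) + 135 * (Q ^ 4 - 1) ^ 2 + 81 * (Q ^ 4 - 1) ^ 3) * (y ^ 4 - 1) ^ 2
    + (120 * (Q ^ 4 - 1) + 279 * (Q ^ 4 - 1) ^ 2 + 162 * (Q ^ 4 - 1) ^ 3) * (y ^ 4 - 1)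
    + (64 * (Q ^ 4 - 1) + 144 * (Q ^ 4 - 1) ^ 2 + 81 * (Q ^ 4 - 1) ^ 3) := by
    linear_combination (Q ^ 3 + 3 * y * Q ^ 4 + 6 * y ^ 2 * Q ^ 5 + y ^ 3 * Q ^ 2
      + 9 * y ^ 3 * Q ^ 6 - 6 * y ^ 4 * Q ^ 3 + 18 * y ^ 4 * Q ^ 7 - 15 * y ^ 5 * Q ^ 4
      + 27 * y ^ 5 * Q ^ 8 + y ^ 6 * Q - 18 * y ^ 6 * Q ^ 5 + 27 * y ^ 6 * Q ^ 9
      - 3 * y ^ 7 * Q ^ 2 + 9 * y ^ 7 * Q ^ 6 + 3 * y ^ 8 * Q ^ 3 + y ^ 9) * hc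
  generalize y ^ 4 - 1 = t at *
  linear_combination y ^ i * t ^ k * key

/-- The three recurrence coefficients have weights `-1`, `-2`, `-3`, matching a loss of one per
power of `𝔰`. They are divisible by `𝔰`, so the `k = 0` value may have a constant term. -/
theorem trisect_wt_of_base (i : ℕ) (q : ℤ⟦X⟧) (c : ℤ)
    (h0 : ∃ r ∈ wt 𝔰 c, trisect (P ^ i) = q * r)
    (h1 : ∃ r ∈ wtPos 𝔰 (c - 1), trisect (P ^ i * 𝔰) = q * r)
    (h2 : ∃ r ∈ wtPos 𝔰 (c - 2), trisect (P ^ i * 𝔰 ^ 2) = q * r) (k : ℕ) (hk : 1 ≤ k) :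
    ∃ r ∈ wtPos 𝔰 (c - k), trisect (P ^ i * 𝔰 ^ k) = q * r := by
  have he1 : 57 * 𝔰 + 135 * 𝔰 ^ 2 + 81 * 𝔰 ^ 3 ∈ wtPos 𝔰 (-1) := by
    have a := mul_pow_mem_wtPos (s := 𝔰) (c := -1) 19 1 1 (by simp) (by simp)
    have b := mul_pow_mem_wtPos (s := 𝔰) (c := -1) 5 3 2 (by simp) (by simp)
    have d := mul_pow_mem_wtPos (s := 𝔰) (c := -1) 1 4 3 (by simp) (by simp)
    convert add_mem (add_mem a b) d using 1
    push_cast; ring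
  have he2 : 120 * 𝔰 + 279 * 𝔰 ^ 2 + 162 * 𝔰 ^ 3 ∈ wtPos 𝔰 (-2) := by
    have a := mul_pow_mem_wtPos (s := 𝔰) (c := -2) 40 1 1 (by simp) (by simp)
    have b := mul_pow_mem_wtPos (s := 𝔰) (c := -2) 31 2 2 (by simp) (by simp)
    have d := mul_pow_mem_wtPos (s := 𝔰) (c := -2) 2 4 3 (by simp) (by simp)
    convert add_mem (add_mem a b) d using 1
    push_cast; ring
  have he3 : 64 * 𝔰 + 144 * 𝔰 ^ 2 + 81 * 𝔰 ^ 3 ∈ wtPos 𝔰 (-3) := by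
    have a := mul_pow_mem_wtPos (s := 𝔰) (c := -3) 64 0 1 (by simp) (by simp)
    have b := mul_pow_mem_wtPos (s := 𝔰) (c := -3) 16 2 2 (by simp) (by simp)
    have d := mul_pow_mem_wtPos (s := 𝔰) (c := -3) 1 4 3 (by simp) (by simp)
    convert add_mem (add_mem a b) d using 1
    push_cast; ring
  have step : ∀ k : ℕ, (∃ r ∈ wt 𝔰 (c - k), trisect (P ^ i * 𝔰 ^ k) = q * r) ∧
      (∃ r ∈ wtPos 𝔰 (c - (k + 1 : ℕ)), trisect (P ^ i * 𝔰 ^ (k + 1)) = q * r) ∧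
      (∃ r ∈ wtPos 𝔰 (c - (k + 2 : ℕ)), trisect (P ^ i * 𝔰 ^ (k + 2)) = q * r) := by
    intro k
    induction k with
    | zero => exact ⟨by simpa using h0, by simpa using h1, by simpa using h2⟩
    | succ k ih =>
      obtain ⟨⟨r0, hr0, t0⟩, ⟨r1, hr1, t1⟩, ⟨r2, hr2, t2⟩⟩ := ih
      refine ⟨⟨r1, wtPos_le_wt _ hr1, t1⟩, ⟨r2, hr2, t2⟩, ?_⟩
      have m1 := wtPos_mul_wt he1 (wtPos_le_wt _ hr2)
      have m2 := wtPos_mul_wt he2 (wtPos_le_wt _ hr1)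
      have m3 := wtPos_mul_wt he3 hr0
      refine ⟨_, add_mem (add_mem (wtPos_anti ?_ m1) (wtPos_anti ?_ m2)) (wtPos_anti ?_ m3), ?_⟩
      · push_cast; omega
      · push_cast; omega
      · push_cast; omega
      · rw [show k + 1 + 2 = k + 3 by rfl, trisect_pow_recurrence, t0, t1, t2]; ring
  obtain ⟨k, rfl⟩ := Nat.exists_eq_add_of_le' hk
  exact (step k).2.1

/-- These are the powers needed to expand `P * 𝔰 ^ k` and `P ^ 3 * 𝔰 ^ k` for `k ≤ 2`. -/
theorem trisect_pow_values :
    trisect (P ^ 3) = P - 9 * P ^ 5 + 9 * P ^ 9 ∧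
    trisect (P ^ 5) = -5 * P ^ 3 + 60 * P ^ 7 - 135 * P ^ 11 + 81 * P ^ 15 ∧
    trisect (P ^ 7) = 28 * P ^ 5 - 378 * P ^ 9 + 1323 * P ^ 13 - 1701 * P ^ 17 + 729 * P ^ 21 ∧
    trisect (P ^ 9) = P ^ 3 - 162 * P ^ 7 + 2349 * P ^ 11 - 10935 * P ^ 15 + 21870 * P ^ 19
      - 19683 * P ^ 23 + 6561 * P ^ 27 ∧
    trisect (P ^ 11) = -11 * P ^ 5 + 957 * P ^ 9 - 14553 * P ^ 13 + 82863 * P ^ 17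
      - 224532 * P ^ 21 + 312741 * P ^ 25 - 216513 * P ^ 29 + 59049 * P ^ 33 := by
  obtain ⟨h1, h2⟩ := trisect_ph3Series_and_sq
  have h0 : trisect 1 = 1 := by
    conv_lhs => rw [← map_one (PowerSeries.expand 3 three_ne_zero), trisect_expand]
  have r0 := trisect_recurrence 0
  have r1 := trisect_recurrence 1
  have r2 := trisect_recurrence 2
  have r3 := trisect_recurrence 3
  have r4 := trisect_recurrence 4
  have r5 := trisect_recurrence 5
  have r6 := trisect_recurrence 6
  have r7 := trisect_recurrence 7
  have r8 := trisect_recurrence 8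
  norm_num only [pow_zero, pow_one] at r0 r1 r2 r3 r4 r5 r6 r7 r8
  rw [h0, h1, h2] at r0
  rw [r0, h1, h2] at r1
  rw [r1, r0, h2] at r2
  ring_nf at r0 r1 r2
  rw [r2, r1, r0] at r3
  ring_nf at r3
  rw [r3, r2, r1] at r4
  ring_nf at r4
  rw [r4, r3, r2] at r5
  ring_nf at r5
  rw [r5, r4, r3] at r6
  ring_nf at r6
  rw [r6, r5, r4] at r7
  ring_nf at r7
  rw [r7, r6, r5] at r8
  refine ⟨?_, ?_, ?_, ?_, ?_⟩
  · rw [r0]; ring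
  · rw [r2]; ring
  · rw [r4]; ring
  · rw [r6]; ring
  · rw [r8]; ring

theorem trisect_mul_pow_wt (k : ℕ) (hk : 1 ≤ k) :
    ∃ r ∈ wtPos 𝔰 (-k), trisect (P * 𝔰 ^ k) = P ^ 3 * r := by
  obtain ⟨-, t5, -, t9, -⟩ := trisect_pow_values
  obtain ⟨t1, -⟩ := trisect_ph3Series_and_sq
  have h := trisect_wt_of_base 1 (P ^ 3) 0 ?_ ?_ ?_ k hk
  · simpa using h
  · refine ⟨_, mul_pow_mem_wt 1 0 0 (by simp), ?_⟩
    rw [pow_one, t1]; simp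
  -- The constants here and below come from rewriting the values in powers of `𝔰 = P^4 - 1`.
  · have a := mul_pow_mem_wtPos (s := 𝔰) (c := -1) 11 1 1 (by simp) (by simp)
    have b := mul_pow_mem_wtPos (s := 𝔰) (c := -1) 4 3 2 (by simp) (by simp)
    have d := mul_pow_mem_wtPos (s := 𝔰) (c := -1) 1 4 3 (by simp) (by simp)
    refine ⟨_, add_mem (add_mem a b) d, ?_⟩
    rw [show P ^ 1 * 𝔰 = P ^ 5 - P by ring, map_sub, t5, t1]
    push_cast; ring
  · have a := mul_pow_mem_wtPos (s := 𝔰) (c := -2) 32 1 1 (by simp) (by simp)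
    have b := mul_pow_mem_wtPos (s := 𝔰) (c := -2) 79 3 2 (by simp) (by simp)
    have d := mul_pow_mem_wtPos (s := 𝔰) (c := -2) 133 4 3 (by simp) (by simp)
    have e := mul_pow_mem_wtPos (s := 𝔰) (c := -2) 10 7 4 (by simp) (by simp)
    have f := mul_pow_mem_wtPos (s := 𝔰) (c := -2) 1 9 5 (by simp) (by simp)
    have g := mul_pow_mem_wtPos (s := 𝔰) (c := -2) 1 8 6 (by simp) (by simp)
    refine ⟨_, add_mem (add_mem (add_mem (add_mem (add_mem a b) d) e) f) g, ?_⟩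
    rw [show P ^ 1 * 𝔰 ^ 2 = P ^ 9 - (P ^ 5 + P ^ 5) + P by ring, map_add, map_sub, map_add,
      t9, t5, t1]
    push_cast; ring

theorem trisect_cube_mul_pow_wt (k : ℕ) (hk : 1 ≤ k) :
    ∃ r ∈ wtPos 𝔰 (-2 - k), trisect (P ^ 3 * 𝔰 ^ k) = P * r := by
  obtain ⟨t3, -, t7, -, t11⟩ := trisect_pow_values
  refine trisect_wt_of_base 3 P (-2) ?_ ?_ ?_ k hk
  · have z := mul_pow_mem_wt (s := 𝔰) (c := -2) 1 0 0 (by simp)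
    have a := mul_pow_mem_wt (s := 𝔰) (c := -2) 1 2 1 (by simp)
    have b := mul_pow_mem_wt (s := 𝔰) (c := -2) 1 2 2 (by simp)
    refine ⟨_, add_mem (add_mem z a) b, ?_⟩
    rw [t3]
    push_cast; ring
  · have a := mul_pow_mem_wtPos (s := 𝔰) (c := -2 - 1) 73 0 1 (by simp) (by simp)
    have b := mul_pow_mem_wtPos (s := 𝔰) (c := -2 - 1) 74 2 2 (by simp) (by simp)
    have d := mul_pow_mem_wtPos (s := 𝔰) (c := -2 - 1) 67 3 3 (by simp) (by simp)
    have e := mul_pow_mem_wtPos (s := 𝔰) (c := -2 - 1) 8 5 4 (by simp) (by simp)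
    have f := mul_pow_mem_wtPos (s := 𝔰) (c := -2 - 1) 1 6 5 (by simp) (by simp)
    refine ⟨_, add_mem (add_mem (add_mem (add_mem a b) d) e) f, ?_⟩
    rw [show P ^ 3 * 𝔰 = P ^ 7 - P ^ 3 by ring, map_sub, t7, t3]
    push_cast; ring
  · have a := mul_pow_mem_wtPos (s := 𝔰) (c := -2 - 2) 128 0 1 (by simp) (by simp)
    have b := mul_pow_mem_wtPos (s := 𝔰) (c := -2 - 2) 1843 1 2 (by simp) (by simp)
    have d := mul_pow_mem_wtPos (s := 𝔰) (c := -2 - 2) 1910 3 3 (by simp) (by simp)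
    have e := mul_pow_mem_wtPos (s := 𝔰) (c := -2 - 2) 835 5 4 (by simp) (by simp)
    have f := mul_pow_mem_wtPos (s := 𝔰) (c := -2 - 2) 563 6 5 (by simp) (by simp)
    have g := mul_pow_mem_wtPos (s := 𝔰) (c := -2 - 2) 206 7 6 (by simp) (by simp)
    have l := mul_pow_mem_wtPos (s := 𝔰) (c := -2 - 2) 13 9 7 (by simp) (by simp)
    have n := mul_pow_mem_wtPos (s := 𝔰) (c := -2 - 2) 1 10 8 (by simp) (by simp)
    refine ⟨_, add_mem (add_mem (add_mem (add_mem (add_mem (add_mem (add_mem a b) d) e) f) g) l) n,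
      ?_⟩
    rw [show P ^ 3 * 𝔰 ^ 2 = P ^ 11 - (P ^ 7 + P ^ 7) + P ^ 3 by ring, map_add, map_sub, map_add,
      t11, t7, t3]
    push_cast; ring

theorem trisect_mul_wtPos {m : ℕ} {x : ℤ⟦X⟧} (hx : x ∈ wtPos 𝔰 (2 * m + 1)) :
    ∃ y ∈ wtPos 𝔰 (2 * (m + 1 : ℕ)), trisect (P * x) = P ^ 3 * y := by
  refine map_mem_wtPos trisect P (P ^ 3) _ _ (fun v k hk hv => ?_) hx
  obtain ⟨r, hr, h⟩ := trisect_mul_pow_wt k hk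
  exact ⟨r, wtPos_anti (by push_cast; omega) hr, h⟩

theorem trisect_cube_mul_wtPos {m : ℕ} {x : ℤ⟦X⟧} (hx : x ∈ wtPos 𝔰 (2 * m)) :
    ∃ y ∈ wtPos 𝔰 (2 * m + 1), trisect (P ^ 3 * x) = P * y := by
  refine map_mem_wtPos trisect (P ^ 3) P _ _ (fun v k hk hv => ?_) hx
  obtain ⟨r, hr, h⟩ := trisect_cube_mul_pow_wt k hk
  -- Tight at `k = 1`: `2v ≥ 2m + 3` must be improved to `2m + 4` by parity.
  exact ⟨r, wtPos_anti (by omega) hr, h⟩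

theorem trisect_iterate_three_sub :
    ∃ y ∈ wtPos 𝔰 (2 * (1 : ℕ)), trisect^[3] P - trisect P = P ^ 3 * y := by
  obtain ⟨t3, -⟩ := trisect_pow_values
  obtain ⟨t1, -⟩ := trisect_ph3Series_and_sq
  obtain ⟨r, hr, h⟩ := trisect_mul_pow_wt 1 le_rfl
  obtain ⟨r', hr', h'⟩ := trisect_mul_pow_wt 2 (by simp)
  have c := mul_pow_mem_wt (s := 𝔰) (c := 4) 1 2 0 (by simp)
  refine ⟨_, wtPos_anti ?_ (wtPos_mul_wt (add_mem (wtPos_anti ?_ hr) hr') c), ?_⟩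
  · simp
  · simp
  -- The left side is `U(U(P))`. The factor `9` has weight `4`, the `U`-images weight at least `-2`,
  -- leaving `2`.
  have e : P - 9 * P ^ 5 + 9 * P ^ 9 = P + (9 : ℕ) • (P * 𝔰 ^ 1 + P * 𝔰 ^ 2) := by
    rw [nsmul_eq_mul]; push_cast; ring
  simp only [Function.iterate_succ, Function.iterate_zero, Function.comp_apply, id]
  rw [t1, t3, e, map_add, map_nsmul, map_add, h, h', t1, nsmul_eq_mul]
  push_cast; ring

theorem iterate_trisect_sub (m : ℕ) : ∃ y ∈ wtPos 𝔰 (2 * (m + 1 : ℕ)),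
    trisect^[2 * m + 3] P - trisect^[2 * m + 1] P = P ^ 3 * y := by
  induction m with
  | zero => exact trisect_iterate_three_sub
  | succ m ih =>
    obtain ⟨y, hy, h⟩ := ih
    obtain ⟨z, hz, h1⟩ := trisect_cube_mul_wtPos hy
    obtain ⟨u, hu, h2⟩ := trisect_mul_wtPos hz
    refine ⟨u, hu, ?_⟩
    rw [show 2 * (m + 1) + 3 = 2 * m + 3 + 1 + 1 by ring,
      show 2 * (m + 1) + 1 = 2 * m + 1 + 1 + 1 by ring, ← h2, ← h1, ← h, map_sub, map_sub, ← Function.iterate_succ_apply' trisect,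
      ← Function.iterate_succ_apply' trisect, ← Function.iterate_succ_apply' trisect,
      ← Function.iterate_succ_apply' trisect]

end Recurrence

theorem theorem1p1 (m n : ℕ) (hm : 1 ≤ m) :
    ph3 (3 ^ (2 * m + 1) * n) ≡ ph3 (3 ^ (2 * m - 1) * n) [ZMOD 3 ^ (m + 2)] := by
  obtain ⟨m, rfl⟩ := Nat.exists_eq_add_of_le' hm
  obtain ⟨y, hy, h⟩ := iterate_trisect_sub m
  have hd : (3 : ℤ⟦X⟧) ^ (m + 1 + 2) ∣ trisect^[2 * m + 3] ph3Series
      - trisect^[2 * m + 1] ph3Series := by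
    rw [h]
    exact (dvd_of_mem_wtPos hy).mul_left _
  obtain ⟨f, hf⟩ := hd
  have hc := congrArg (PowerSeries.coeff n) hf
  have h3 : (3 : ℤ⟦X⟧) ^ (m + 1 + 2) = PowerSeries.C (3 ^ (m + 1 + 2)) := by simp
  rw [map_sub, coeff_iterate_trisect, coeff_iterate_trisect, h3, PowerSeries.coeff_C_mul] at hc
  refine (Int.modEq_iff_dvd.mpr ⟨PowerSeries.coeff n f, ?_⟩).symm
  rw [← hc, ph3, ph3, show 2 * (m + 1) + 1 = 2 * m + 3 by ring,
    show 2 * (m + 1) - 1 = 2 * m + 1 by omega]
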